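/- Let $X$ be a random point uniformly distributed in the cube $[0,1]^4$. For a bounded set $C\subset\mathbb{R}^4$, let $$X_C=\left|(C+X)\cap\mathbb{Z}^4\right|$$ be the number of integer points in the randomly shifted set $C+X$, where the same random point $X$ is used for all sets $C$. Let $P\subset\mathbb{R}^4$ be a centrally symmetric integer polytope, that is, the convex hull of finitely many points of $\mathbb{Z}^4$ (not necessarily full-dimensional) which is symmetric with respect to some point $c\in\mathbb{R}^4$: $2c-x\in P$ for every $x\in P$. Then, for every positive integer $n$, the random variables $X_P$ and $X_{nP}$, where $nP=\{nx : x\in P\}$, have finite second moments, $$X_{nP}-\mathbb{E}X_{nP}=n^2\left(X_P-\mathbb{E}X_P\right)\quad\text{almost surely}$$ (equivalently, $X_{nP}-n^2X_P$ is almost surely equal to a constant), and $$\operatorname{Var}X_{nP}=n^4\operatorname{Var}X_P .$$ -/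

import Mathlib

open MeasureTheory ProbabilityTheory
open scoped Pointwise

/-- A point of `ℝ^d` all of whose coordinates are integers. -/
def IsIntegerPoint {d : ℕ} (x : Fin d → ℝ) : Prop :=
  ∀ i, ∃ z : ℤ, x i = (z : ℝ)

/-- An integer (lattice) polytope in `ℝ^d`: the convex hull of finitely many integer points. -/
def IsIntegerPolytope {d : ℕ} (P : Set (Fin d → ℝ)) : Prop :=
  ∃ V : Set (Fin d → ℝ), V.Finite ∧ (∀ v ∈ V, IsIntegerPoint v) ∧ P = convexHull ℝ V

/-- `P` is symmetric with respect to some point `c` (not necessarily the origin). -/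
def IsCentrallySymmetric {d : ℕ} (P : Set (Fin d → ℝ)) : Prop :=
  ∃ c : Fin d → ℝ, ∀ x ∈ P, (2 : ℝ) • c - x ∈ P

/-- The number of integer points in the translate `C + x`
(a finite number whenever `C` is bounded). -/
noncomputable def latticeCount {d : ℕ} (C : Set (Fin d → ℝ)) (x : Fin d → ℝ) : ℕ :=
  ((C + {x}) ∩ {m | IsIntegerPoint m}).ncard

/-- The random variable `X_C = |(C + X) ∩ ℤ^d|` generated by `C` and a random point `X`. -/
noncomputable def shiftCount {Ω : Type*} {d : ℕ} (X : Ω → Fin d → ℝ) (C : Set (Fin d → ℝ)) :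
    Ω → ℝ :=
  fun ω => (latticeCount C (X ω) : ℝ)

/-- Two random variables differ by a constant: `Y - 𝔼 Y = Z - 𝔼 Z` almost surely. -/
def EqUpToConst {Ω : Type*} [MeasurableSpace Ω] (μ : Measure Ω) (Y Z : Ω → ℝ) : Prop :=
  ∀ᵐ ω ∂μ, Y ω - ∫ ω', Y ω' ∂μ = Z ω - ∫ ω', Z ω' ∂μ

/-! As a function of the shift, the lattice count of `C` is periodic, and its Fourier coefficients
are the Fourier integrals of the indicator of `C` (`integral_expChar_mul_latticeCount`). So it
suffices that passing from `P` to `nP` multiplies every coefficient with `k ≠ 0` by `n ^ 2`: the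
difference of counts then has only a constant term, and the variance follows.

Scaling turns the coefficient of `nP` at `k` into `n ^ 4` times that of `P` at `nk`, so the question
is how the transform of `P` behaves along the ray `Nk`. Triangulating `P` into lattice simplices and
integrating exponentials shows that it equals `∑ c b * N ^ (-b)` with `b = 0, ..., 3`
(`IsIntegerPolytope.exists_setFourier_eq_sum`); integrality of the vertices makes all phases
trivial. Riemann–Lebesgue kills `b = 0`. Twice the centre is a lattice point, so the transform is
even and the odd terms vanish. Only `c 2 * N ^ (-2)` is left, and `n ^ 4 * n ^ (-2) = n ^ 2`. -/

theorem volume_convexHull_image_eq_zero {ι E : Type*}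
    [NormedAddCommGroup E] [NormedSpace ℝ E] [FiniteDimensional ℝ E] [MeasurableSpace E] [BorelSpace E]
    (μ : Measure E) [μ.IsAddHaarMeasure] (p : ι → E) {S : Finset ι}
    (hS : S.card ≤ Module.finrank ℝ E) : μ (convexHull ℝ (p '' S)) = 0 := by
  refine measure_mono_null (convexHull_subset_affineSpan _) ?_
  apply Measure.addHaar_affineSubspace
  intro htop
  rcases S.eq_empty_or_nonempty with rfl | hne
  · simp at htop
  classical
  have hc : 0 < S.card := hne.card_pos
  have h1 := finrank_vectorSpan_image_finset_le ℝ p S (n := S.card - 1) (by omega)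
  have h2 : vectorSpan ℝ (p '' (S : Set ι)) = ⊤ := by
    rw [← direction_affineSpan, htop, AffineSubspace.direction_top]
  rw [Finset.coe_image, h2, finrank_top] at h1
  omega

/-! ### Regular triangulation of a polytope by linear programming with a generic cost. -/

section Triangulation

variable {ι : Type*} [Fintype ι] {E : Type*} [NormedAddCommGroup E] [NormedSpace ℝ E]

/-- The convex weights on the points `p i` which represent the point `x`. -/
def convexWeights (p : ι → E) (x : E) : Set (ι → ℝ) :=
  {l | (∀ i, 0 ≤ l i) ∧ ∑ i, l i = 1 ∧ ∑ i, l i • p i = x}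

/-- `m` is an affine dependency of the points `p i`. -/
def IsAffineDependency (p : ι → E) (m : ι → ℝ) : Prop :=
  ∑ i, m i = 0 ∧ ∑ i, m i • p i = 0

theorem mem_convexHull_image_iff_convexWeights (p : ι → E) (S : Set ι) (x : E) :
    x ∈ convexHull ℝ (p '' S) ↔ ∃ l ∈ convexWeights p x, ∀ i ∉ S, l i = 0 := by
  classical
  constructor
  · intro hx
    have hsub : convexHull ℝ (p '' S) ⊆
        {x | ∃ l ∈ convexWeights p x, ∀ i ∉ S, l i = 0} := by
      apply convexHull_min
      · rintro _ ⟨i, hi, rfl⟩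
        refine ⟨Pi.single i 1, ⟨fun j => ?_, by simp, by simp [Pi.single_apply]⟩, fun j hj => ?_⟩
        · by_cases h : j = i
          · subst h; simp
          · simp [h]
        · have : j ≠ i := fun h => hj (h ▸ hi)
          simp [this]
      · rintro x ⟨l, ⟨h0, h1, h2⟩, h3⟩ y ⟨l', ⟨h0', h1', h2'⟩, h3'⟩ a b ha hb hab
        refine ⟨fun i => a * l i + b * l' i, ⟨fun i => ?_, ?_, ?_⟩, fun i hi => ?_⟩
        · have := h0 i; have := h0' i; positivity
        · rw [Finset.sum_add_distrib, ← Finset.mul_sum, ← Finset.mul_sum, h1, h1']; simpa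
        · simp_rw [add_smul, mul_smul]
          rw [Finset.sum_add_distrib, ← Finset.smul_sum, ← Finset.smul_sum, h2, h2']
        · simp [h3 i hi, h3' i hi]
    exact hsub hx
  · rintro ⟨l, ⟨h0, h1, h2⟩, h3⟩
    have hs : ∀ f : ι → E, (∀ i ∉ S, f i = 0) →
        ∑ i, f i = ∑ i ∈ Finset.univ.filter (· ∈ S), f i := fun f hf => by
      rw [Finset.sum_filter]
      exact Finset.sum_congr rfl fun i _ => by split_ifs with h <;> simp [hf, h]
    rw [← h2, hs _ fun i hi => by simp [h3 i hi]]
    refine (convex_convexHull ℝ _).sum_mem (fun i _ => h0 i) ?_ fun i hi =>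
      subset_convexHull ℝ _ ⟨i, (Finset.mem_filter.1 hi).2, rfl⟩
    rw [← h1, Finset.sum_filter]
    exact Finset.sum_congr rfl fun i _ => by split_ifs with h <;> simp [h3, h]

theorem isCompact_convexWeights (p : ι → E) (x : E) : IsCompact (convexWeights p x) := by
  have h : convexWeights p x = stdSimplex ℝ ι ∩ {l | ∑ i, l i • p i = x} := by
    ext l; simp [convexWeights, stdSimplex, and_assoc]
  rw [h]
  exact (isCompact_stdSimplex ℝ ι).inter_right (isClosed_eq (by fun_prop) continuous_const)

/-- The weight `l` has least cost among the convex weights representing `x`. -/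
def IsOptimalWeight (p : ι → E) (w : ι → ℝ) (x : E) (l : ι → ℝ) : Prop :=
  l ∈ convexWeights p x ∧ ∀ l' ∈ convexWeights p x, ∑ i, w i * l i ≤ ∑ i, w i * l' i

theorem exists_isOptimalWeight (p : ι → E) (w : ι → ℝ) {x : E}
    (hx : x ∈ convexHull ℝ (Set.range p)) : ∃ l, IsOptimalWeight p w x l := by
  rw [← Set.image_univ, mem_convexHull_image_iff_convexWeights] at hx
  obtain ⟨l, hl, -⟩ := hx
  obtain ⟨l, hl, hmin⟩ := (isCompact_convexWeights p x).exists_isMinOn ⟨l, hl⟩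
    (f := fun l => ∑ i, w i * l i) (by fun_prop)
  exact ⟨l, hl, fun l' hl' => hmin hl'⟩

theorem exists_pos_forall_nonneg_add_mul {l m : ι → ℝ} (hl : ∀ i, 0 ≤ l i)
    (hm : ∀ i, l i = 0 → 0 ≤ m i) : ∃ ε > 0, ∀ i, 0 ≤ l i + ε * m i := by
  have h : ∀ᶠ ε in nhdsWithin (0 : ℝ) (Set.Ioi 0), ∀ i, 0 ≤ l i + ε * m i := by
    rw [Filter.eventually_all]
    intro i
    rcases (hl i).eq_or_lt with h | h
    · filter_upwards [self_mem_nhdsWithin] with ε hε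
      rw [← h, zero_add]
      exact mul_nonneg (le_of_lt hε) (hm i h.symm)
    · have : Filter.Tendsto (fun ε : ℝ => l i + ε * m i) (nhdsWithin 0 (Set.Ioi 0))
          (nhds (l i + 0 * m i)) :=
        (Continuous.tendsto (by fun_prop) 0).mono_left nhdsWithin_le_nhds
      rw [zero_mul, add_zero] at this
      exact (this.eventually (lt_mem_nhds h)).mono fun _ h => h.le
  obtain ⟨ε, h1, h2⟩ := (h.and self_mem_nhdsWithin).exists
  exact ⟨ε, h2, h1⟩

/-- First-order optimality: a small step from `l` along `m` stays feasible, since `m` is nonnegative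
wherever `l` vanishes. -/
theorem IsOptimalWeight.cost_nonneg {p : ι → E} {w : ι → ℝ} {x : E} {l m : ι → ℝ}
    (h : IsOptimalWeight p w x l) (hm : IsAffineDependency p m) (h0 : ∀ i, l i = 0 → 0 ≤ m i) :
    0 ≤ ∑ i, w i * m i := by
  obtain ⟨⟨hl0, hl1, hl2⟩, hmin⟩ := h
  obtain ⟨ε, hε, hpos⟩ := exists_pos_forall_nonneg_add_mul hl0 h0
  have := hmin (fun i => l i + ε * m i) ⟨hpos, ?_, ?_⟩
  · simp_rw [mul_add, mul_left_comm _ ε] at this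
    rw [Finset.sum_add_distrib, ← Finset.mul_sum] at this
    have h3 : 0 ≤ ε * ∑ i, w i * m i := by linarith
    exact nonneg_of_mul_nonneg_right h3 hε
  · rw [Finset.sum_add_distrib, ← Finset.mul_sum, hl1, hm.1]; simp
  · simp_rw [add_smul, mul_smul]
    rw [Finset.sum_add_distrib, ← Finset.smul_sum, hl2, hm.2]; simp

theorem IsAffineDependency.neg {p : ι → E} {m : ι → ℝ} (hm : IsAffineDependency p m) :
    IsAffineDependency p (-m) := by
  simpa [IsAffineDependency] using hm

theorem isAffineDependency_sub {p : ι → E} {x : E} {l l' : ι → ℝ} (h : l ∈ convexWeights p x)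
    (h' : l' ∈ convexWeights p x) : IsAffineDependency p (l' - l) := by
  simp [IsAffineDependency, sub_smul, h.2.1, h'.2.1, h.2.2, h'.2.2]

/-- The cost `w` separates affine dependencies: whenever a set of indices carries a nonzero
dependency, it carries one of nonzero cost. -/
def IsGenericCost (p : ι → E) (w : ι → ℝ) : Prop :=
  ∀ A : Set ι, (∃ m ≠ 0, IsAffineDependency p m ∧ ∀ i ∉ A, m i = 0) →
    ∃ m, IsAffineDependency p m ∧ (∀ i ∉ A, m i = 0) ∧ ∑ i, w i * m i ≠ 0

/-- There are finitely many index sets `A`; choose a nonzero dependency on each dependent one and a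
linear functional vanishing at none of them. Its coordinates are `w`. -/
theorem exists_isGenericCost (p : ι → E) : ∃ w, IsGenericCost p w := by
  classical
  let J := {A : Set ι // ∃ m ≠ 0, IsAffineDependency p m ∧ ∀ i ∉ A, m i = 0}
  choose m hm0 hm hmA using fun A : J => A.2
  obtain ⟨f, hf⟩ := Module.exists_dual_forall_apply_ne_zero (K := ℝ) m hm0
  refine ⟨fun i => f (Pi.single i 1), fun A hA => ⟨m ⟨A, hA⟩, hm _, hmA ⟨A, hA⟩, ?_⟩⟩
  convert hf ⟨A, hA⟩
  conv_rhs => rw [← LinearMap.sum_single_apply (fun _ => ℝ) (m ⟨A, hA⟩), map_sum]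
  refine Finset.sum_congr rfl fun i _ => ?_
  have : (LinearMap.single ℝ (fun _ => ℝ) i) (m ⟨A, hA⟩ i) =
      m ⟨A, hA⟩ i • (Pi.single i (1 : ℝ) : ι → ℝ) := by
    ext j; by_cases h : j = i
    · subst h; simp
    · simp [h]
  rw [LinearMap.coe_single] at this
  rw [this, map_smul, smul_eq_mul, mul_comm]

/-- On the support of an optimal weight both `m'` and `-m'` are feasible directions, so every
dependency there costs zero; genericity then leaves only the trivial one. -/
theorem IsOptimalWeight.dependency_eq_zero {p : ι → E} {w : ι → ℝ} (hw : IsGenericCost p w)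
    {x : E} {l : ι → ℝ} (h : IsOptimalWeight p w x l) {m : ι → ℝ} (hm : IsAffineDependency p m)
    (h0 : ∀ i, l i = 0 → m i = 0) : m = 0 := by
  by_contra hne
  obtain ⟨m', hm', h0', hne'⟩ := hw {i | l i ≠ 0} ⟨m, hne, hm, fun i hi => h0 i (by simpa using hi)⟩
  have h0'' : ∀ i, l i = 0 → m' i = 0 := fun i hi => h0' i (by simpa using hi)
  have h1 := h.cost_nonneg hm' fun i hi => (h0'' i hi).ge
  have h2 := h.cost_nonneg hm'.neg fun i hi => by simp [h0'' i hi]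
  simp only [Pi.neg_apply, mul_neg, Finset.sum_neg_distrib] at h2
  exact hne' (by linarith)

theorem IsOptimalWeight.affineIndependent {p : ι → E} {w : ι → ℝ} (hw : IsGenericCost p w)
    {x : E} {l : ι → ℝ} (h : IsOptimalWeight p w x l) :
    AffineIndependent ℝ fun i : {i // l i ≠ 0} => p i := by
  classical
  rw [affineIndependent_iff]
  intro s g hg0 hg1 e he
  let m : ι → ℝ := fun i => if h : ∃ hi : l i ≠ 0, ⟨i, hi⟩ ∈ s then g ⟨i, h.1⟩ else 0
  have hmem : ∀ i ∈ s, m i = g i := fun i hi => by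
    simp only [m]; rw [dif_pos ⟨i.2, hi⟩]
  have hnot : ∀ i, i ∉ Subtype.val '' (s : Set {i // l i ≠ 0}) → m i = 0 := fun i hi => by
    simp only [m]
    rw [dif_neg]
    rintro ⟨h1, h2⟩
    exact hi ⟨_, h2, rfl⟩
  have hm : IsAffineDependency p m := by
    constructor
    · rw [← hg0]
      symm
      exact Finset.sum_of_injOn Subtype.val Subtype.val_injective.injOn (by simp [Set.MapsTo])
        (fun i _ hi => hnot i hi) fun i hi => (hmem i hi).symm
    · rw [← hg1]
      symm
      exact Finset.sum_of_injOn Subtype.val Subtype.val_injective.injOn (by simp [Set.MapsTo])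
        (fun i _ hi => by rw [hnot i hi, zero_smul]) fun i hi => by rw [hmem i hi]
  have h0 := h.dependency_eq_zero hw hm fun i hi => by
    refine hnot i ?_
    rintro ⟨j, -, rfl⟩
    exact j.2 hi
  rw [← hmem e he, h0, Pi.zero_apply]

theorem IsOptimalWeight.eq {p : ι → E} {w : ι → ℝ} (hw : IsGenericCost p w)
    {x : E} {l l' : ι → ℝ} (h : IsOptimalWeight p w x l) (h' : IsOptimalWeight p w x l') :
    l = l' := by
  -- The support of the midpoint contains both supports, hence that of the dependency `l - l'`.
  have hmid : IsOptimalWeight p w x (fun i => (l i + l' i) / 2) := by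
    obtain ⟨⟨a, b, c⟩, hmin⟩ := h
    obtain ⟨⟨a', b', c'⟩, hmin'⟩ := h'
    refine ⟨⟨fun i => by linarith [a i, a' i], ?_, ?_⟩, fun l'' hl'' => ?_⟩
    · rw [← Finset.sum_div, Finset.sum_add_distrib, b, b']; norm_num
    · simp_rw [div_eq_inv_mul, mul_smul, add_smul]
      rw [← Finset.smul_sum, Finset.sum_add_distrib, c, c', ← two_smul ℝ x, smul_smul]
      norm_num
    · have h1 := hmin l'' hl''
      have h2 := hmin' l'' hl''
      have : ∑ i, w i * ((l i + l' i) / 2) = ((∑ i, w i * l i) + ∑ i, w i * l' i) / 2 := by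
        rw [← Finset.sum_add_distrib, Finset.sum_div]
        exact Finset.sum_congr rfl fun i _ => by ring
      linarith
  have := hmid.dependency_eq_zero hw (isAffineDependency_sub h'.1 h.1) fun i hi => ?_
  · exact sub_eq_zero.1 this
  · have := h.1.1 i; have := h'.1.1 i
    simp only [Pi.sub_apply]
    linarith

/-- A weight supported in the support of an optimal weight (for any point) is optimal. -/
theorem IsOptimalWeight.of_support_subset {p : ι → E} {w : ι → ℝ} {x y : E} {l l' : ι → ℝ}
    (h : IsOptimalWeight p w x l) (h' : l' ∈ convexWeights p y) (h0 : ∀ i, l i = 0 → l' i = 0) :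
    IsOptimalWeight p w y l' := by
  refine ⟨h', fun l'' h'' => ?_⟩
  have := h.cost_nonneg (isAffineDependency_sub h' h'') fun i hi => by
    simpa [h0 i hi] using h''.1 i
  simp only [Pi.sub_apply, mul_sub, Finset.sum_sub_distrib] at this
  linarith

/-- Every polytope is, up to a null set, a disjoint union of full-dimensional simplices with
vertices among the given points. -/
theorem exists_triangulation [FiniteDimensional ℝ E] [MeasurableSpace E] [BorelSpace E]
    (μ : Measure E) [μ.IsAddHaarMeasure] (p : ι → E) :
    ∃ T : Finset (Finset ι), (∀ S ∈ T, S.card = Module.finrank ℝ E + 1) ∧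
      ∀ᵐ x ∂μ, x ∈ convexHull ℝ (Set.range p) →
        ∃ S ∈ T, ∀ S' ∈ T, x ∈ convexHull ℝ (p '' S') ↔ S' = S := by
  classical
  obtain ⟨w, hw⟩ := exists_isGenericCost p
  have hnull : ∀ᵐ x ∂μ, ∀ S : Finset ι, S.card ≤ Module.finrank ℝ E →
      x ∉ convexHull ℝ (p '' (S : Set ι)) := by
    rw [ae_all_iff]
    intro S
    by_cases hS : S.card ≤ Module.finrank ℝ E
    · filter_upwards [measure_eq_zero_iff_ae_notMem.1 (volume_convexHull_image_eq_zero μ p hS)]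
        with x hx _ using hx
    · exact Filter.Eventually.of_forall fun x h => absurd h hS
  -- The cells are the full-size supports of optimal weights, i.e. the projected lower facets of the
  -- points lifted to heights `w`.
  refine ⟨Finset.univ.filter fun S => S.card = Module.finrank ℝ E + 1 ∧
    ∃ x l, IsOptimalWeight p w x l ∧ ∀ i, l i ≠ 0 ↔ i ∈ S, fun S hS => (Finset.mem_filter.1 hS).2.1,
    ?_⟩
  filter_upwards [hnull] with x hx hxP
  obtain ⟨l, hl⟩ := exists_isOptimalWeight p w hxP
  have hlow : ∀ l' ∈ convexWeights p x,
      Module.finrank ℝ E + 1 ≤ (Finset.univ.filter fun i => l' i ≠ 0).card := by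
    intro l' hl'
    by_contra hlt
    refine hx (Finset.univ.filter fun i => l' i ≠ 0) (by omega) ?_
    rw [mem_convexHull_image_iff_convexWeights]
    exact ⟨l', hl', fun i hi => by simpa using hi⟩
  have hup : (Finset.univ.filter fun i => l i ≠ 0).card ≤ Module.finrank ℝ E + 1 := by
    rw [← Fintype.card_subtype]
    exact (hl.affineIndependent hw).card_le_finrank_succ.trans
      (Nat.add_le_add_right (Submodule.finrank_le _) 1)
  refine ⟨Finset.univ.filter fun i => l i ≠ 0, ?_, fun S' hS' => ⟨fun hxS => ?_, ?_⟩⟩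
  · simp only [Finset.mem_filter, Finset.mem_univ, true_and]
    exact ⟨le_antisymm hup (hlow l hl.1), x, l, hl, fun i => by simp⟩
  · obtain ⟨hcard, y, ly, hy, hsupp⟩ := (Finset.mem_filter.1 hS').2
    obtain ⟨l', hl', h0⟩ := (mem_convexHull_image_iff_convexWeights _ _ _).1 hxS
    -- Any representation of `x` on a cell is optimal, so by uniqueness `x` lies in only one cell.
    have hopt : IsOptimalWeight p w x l' :=
      hy.of_support_subset hl' fun i hi => h0 i fun hmem => (hsupp i).2 hmem hi
    have := hl.eq hw hopt
    subst this
    refine (Finset.eq_of_subset_of_card_le (fun i hi => ?_) ?_).symm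
    · by_contra hi'
      exact (Finset.mem_filter.1 hi).2 (h0 i hi')
    · rw [hcard]; exact hlow l hl'
  · rintro rfl
    rw [mem_convexHull_image_iff_convexWeights]
    exact ⟨l, hl.1, fun i hi => by simpa using hi⟩

end Triangulation

/-! ### Fourier integrals of the corner simplex along a ray of frequencies. -/

section SimplexFourier

/-- The additive character `x ↦ exp (2 π i x)` of `ℝ`. -/
noncomputable def expChar (x : ℝ) : ℂ := Complex.exp (2 * Real.pi * Complex.I * x)

theorem expChar_add (x y : ℝ) : expChar (x + y) = expChar x * expChar y := by
  simp [expChar, ← Complex.exp_add, mul_add]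

theorem expChar_zero : expChar 0 = 1 := by simp [expChar]

theorem expChar_intCast (n : ℤ) : expChar n = 1 := by
  rw [expChar, Complex.exp_eq_one_iff]
  exact ⟨n, by push_cast; ring⟩

theorem norm_expChar (x : ℝ) : ‖expChar x‖ = 1 := by
  rw [expChar, show 2 * (Real.pi : ℂ) * Complex.I * x = ((2 * Real.pi * x : ℝ) : ℂ) * Complex.I by
    push_cast; ring]
  exact Complex.norm_exp_ofReal_mul_I _

@[fun_prop]
theorem continuous_expChar : Continuous expChar := by unfold expChar; fun_prop

theorem hasDerivAt_expChar (x : ℝ) :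
    HasDerivAt expChar (2 * Real.pi * Complex.I * expChar x) x := by
  have h : HasDerivAt (fun x : ℝ => 2 * Real.pi * Complex.I * (x : ℂ))
      (2 * Real.pi * Complex.I) x := by
    simpa using (Complex.ofRealCLM.hasDerivAt (x := x)).const_mul (2 * Real.pi * Complex.I)
  rw [mul_comm]
  exact h.cexp

/-- The elementary function `r ^ a * N ^ (-b) * exp (2 π i N q r)`. -/
noncomputable def expMonomial (a b : ℕ) (q : ℤ) (r : ℝ) (N : ℤ) : ℂ :=
  (r : ℂ) ^ a * ((N : ℂ) ^ b)⁻¹ * expChar (N * q * r)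

/-- The span of the elementary functions `r ^ a * N ^ (-b) * exp (2 π i N q r)` with
`a + b = d`. -/
def expMonomialSpan (d : ℕ) : Submodule ℂ (ℝ → ℤ → ℂ) :=
  Submodule.span ℂ {f | ∃ a b q, a + b = d ∧ f = expMonomial a b q}

theorem expMonomial_mem {a b d : ℕ} (q : ℤ) (h : a + b = d) :
    expMonomial a b q ∈ expMonomialSpan d :=
  Submodule.subset_span ⟨a, b, q, h, rfl⟩

theorem continuous_expMonomial (a b : ℕ) (q N : ℤ) :
    Continuous fun r => expMonomial a b q r N := by
  unfold expMonomial; fun_prop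

theorem continuous_of_mem_expMonomialSpan {d : ℕ} {f : ℝ → ℤ → ℂ} (hf : f ∈ expMonomialSpan d)
    (N : ℤ) : Continuous fun r => f r N := by
  induction hf using Submodule.span_induction with
  | mem f h => obtain ⟨a, b, q, -, rfl⟩ := h; exact continuous_expMonomial a b q N
  | zero => exact continuous_const
  | add f g _ _ hf hg => exact hf.add hg
  | smul c f _ hf => exact hf.const_smul c

/-- Integration by parts: each round lowers `a` and raises `b` by one, so the total degree is kept.
In the case `a = 0` the truncated `a - 1` is harmless because of the factor `a`. -/
theorem integral_expMonomial_of_ne (a : ℕ) : ∀ (b : ℕ) (q m : ℤ), q ≠ m →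
    ∃ g ∈ expMonomialSpan (a + b + 1), ∀ (r : ℝ) (N : ℤ), N ≠ 0 →
      ∫ t in (0 : ℝ)..r, expChar (N * m * (r - t)) * expMonomial a b q t N = g r N := by
  have key : ∀ (a b : ℕ) (q m : ℤ), q ≠ m → ∀ (r : ℝ) (N : ℤ), N ≠ 0 → ∀ t : ℝ,
      HasDerivAt (fun t => (2 * Real.pi * Complex.I * (q - m))⁻¹ *
        (expChar (N * m * (r - t)) * expMonomial a (b + 1) q t N))
      (expChar (N * m * (r - t)) * expMonomial a b q t N +
        (2 * Real.pi * Complex.I * (q - m))⁻¹ * (a * (expChar (N * m * (r - t)) *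
          expMonomial (a - 1) (b + 1) q t N))) t := by
    intro a b q m hqm r N hN t
    have hN' : (N : ℂ) ≠ 0 := by exact_mod_cast hN
    have hqm' : (q : ℂ) - m ≠ 0 := by rw [sub_ne_zero]; exact_mod_cast hqm
    have hpi : (Real.pi : ℂ) ≠ 0 := by exact_mod_cast Real.pi_ne_zero
    have h1 : HasDerivAt (fun t : ℝ => expChar (N * m * (r - t)))
        ((-(N * m) : ℝ) • (2 * Real.pi * Complex.I * expChar (N * m * (r - t)))) t := by
      have : HasDerivAt (fun t : ℝ => (N : ℝ) * m * (r - t)) (-(N * m)) t := by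
        simpa using ((hasDerivAt_id t).const_sub r).const_mul ((N : ℝ) * m)
      exact (hasDerivAt_expChar _).scomp t this
    have h2 : HasDerivAt (fun t : ℝ => expChar (N * q * t))
        (((N * q) : ℝ) • (2 * Real.pi * Complex.I * expChar (N * q * t))) t := by
      have : HasDerivAt (fun t : ℝ => (N : ℝ) * q * t) (N * q) t := by
        simpa using (hasDerivAt_id t).const_mul ((N : ℝ) * q)
      exact (hasDerivAt_expChar _).scomp t this
    have h3 : HasDerivAt (fun t : ℝ => (t : ℂ) ^ a) (a * (t : ℂ) ^ (a - 1)) t := by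
      simpa using (Complex.ofRealCLM.hasDerivAt (x := t)).fun_pow a
    have h4 := ((h1.mul ((h3.mul_const (((N : ℂ) ^ (b + 1))⁻¹)).mul h2)).const_mul
      ((2 * Real.pi * Complex.I * ((q : ℂ) - m))⁻¹))
    refine h4.congr_deriv ?_
    simp only [expMonomial, Complex.real_smul, Pi.mul_apply]
    push_cast
    have hI := Complex.I_ne_zero
    field_simp
    ring
  have hint : ∀ (a b : ℕ) (q m : ℤ) (r : ℝ) (N : ℤ), IntervalIntegrable
      (fun t => expChar (N * m * (r - t)) * expMonomial a b q t N) volume 0 r := by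
    intro a b q m r N
    apply Continuous.intervalIntegrable
    have := continuous_expMonomial a b q N
    fun_prop
  have ftc : ∀ (a b : ℕ) (q m : ℤ), q ≠ m → ∀ (r : ℝ) (N : ℤ), N ≠ 0 →
      ∫ t in (0 : ℝ)..r, expChar (N * m * (r - t)) * expMonomial a b q t N =
        (2 * Real.pi * Complex.I * (q - m))⁻¹ * (expMonomial a (b + 1) q r N -
          expChar (N * m * r) * expMonomial a (b + 1) q 0 N) -
        (2 * Real.pi * Complex.I * (q - m))⁻¹ * (a * ∫ t in (0 : ℝ)..r,
          expChar (N * m * (r - t)) * expMonomial (a - 1) (b + 1) q t N) := by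
    intro a b q m hqm r N hN
    have h := intervalIntegral.integral_eq_sub_of_hasDerivAt
      (fun t _ => key a b q m hqm r N hN t)
      ((hint a b q m r N).add (((hint (a - 1) (b + 1) q m r N).const_mul _).const_mul _))
    rw [intervalIntegral.integral_add (hint a b q m r N)
      (((hint (a - 1) (b + 1) q m r N).const_mul _).const_mul _),
      intervalIntegral.integral_const_mul, intervalIntegral.integral_const_mul] at h
    rw [eq_sub_iff_add_eq, h]
    simp [expChar_zero]
    ring
  induction a with
  | zero =>
    intro b q m hqm
    refine ⟨(2 * Real.pi * Complex.I * ((q : ℂ) - m))⁻¹ •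
      (expMonomial 0 (b + 1) q - expMonomial 0 (b + 1) m),
      Submodule.smul_mem _ _ (Submodule.sub_mem _ (expMonomial_mem q (by ring))
        (expMonomial_mem m (by ring))), fun r N hN => ?_⟩
    rw [ftc 0 b q m hqm r N hN]
    simp [expMonomial, expChar_zero, mul_comm]
  | succ a ih =>
    intro b q m hqm
    obtain ⟨g, hg, hgr⟩ := ih (b + 1) q m hqm
    refine ⟨(2 * Real.pi * Complex.I * ((q : ℂ) - m))⁻¹ • expMonomial (a + 1) (b + 1) q -
      ((2 * Real.pi * Complex.I * ((q : ℂ) - m))⁻¹ * (a + 1 : ℕ)) • g, ?_, fun r N hN => ?_⟩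
    · refine Submodule.sub_mem _ (Submodule.smul_mem _ _ (expMonomial_mem q (by ring)))
        (Submodule.smul_mem _ _ ?_)
      rwa [show a + 1 + b + 1 = a + (b + 1) + 1 by ring]
    · rw [ftc (a + 1) b q m hqm r N hN, Nat.add_sub_cancel, hgr r N hN]
      simp [expMonomial]
      ring

theorem integral_expMonomial (a b : ℕ) (q m : ℤ) :
    ∃ g ∈ expMonomialSpan (a + b + 1), ∀ (r : ℝ) (N : ℤ), N ≠ 0 →
      ∫ t in (0 : ℝ)..r, expChar (N * m * (r - t)) * expMonomial a b q t N = g r N := by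
  -- Resonance: if `q = m` the phases combine to one independent of `t`, and it is the power of `r`
  -- that grows instead of the power of `N⁻¹`.
  by_cases hqm : q = m
  · subst hqm
    refine ⟨((a + 1 : ℂ)⁻¹) • expMonomial (a + 1) b q, Submodule.smul_mem _ _
      (expMonomial_mem q (by ring)), fun r N _ => ?_⟩
    have h : ∀ t : ℝ, expChar (N * q * (r - t)) * expMonomial a b q t N =
        ((N : ℂ) ^ b)⁻¹ * expChar (N * q * r) * ((t ^ a : ℝ) : ℂ) := by
      intro t
      rw [show (N : ℝ) * q * r = N * q * (r - t) + N * q * t by ring, expChar_add, expMonomial]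
      push_cast
      ring
    simp_rw [h]
    rw [intervalIntegral.integral_const_mul, intervalIntegral.integral_ofReal, integral_pow]
    simp [expMonomial]
    ring
  · exact integral_expMonomial_of_ne a b q m hqm

theorem integral_of_mem_expMonomialSpan {d : ℕ} {f : ℝ → ℤ → ℂ} (hf : f ∈ expMonomialSpan d)
    (m : ℤ) : ∃ g ∈ expMonomialSpan (d + 1), ∀ (r : ℝ) (N : ℤ), N ≠ 0 →
      ∫ t in (0 : ℝ)..r, expChar (N * m * (r - t)) * f t N = g r N := by
  induction hf using Submodule.span_induction with
  | mem f h =>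
    obtain ⟨a, b, q, rfl, rfl⟩ := h
    exact integral_expMonomial a b q m
  | zero => exact ⟨0, Submodule.zero_mem _, by simp⟩
  | add f₁ f₂ h₁ h₂ ih₁ ih₂ =>
    obtain ⟨g₁, hg₁, e₁⟩ := ih₁
    obtain ⟨g₂, hg₂, e₂⟩ := ih₂
    refine ⟨g₁ + g₂, Submodule.add_mem _ hg₁ hg₂, fun r N hN => ?_⟩
    have c₁ := continuous_of_mem_expMonomialSpan h₁ N
    have c₂ := continuous_of_mem_expMonomialSpan h₂ N
    simp only [Pi.add_apply, mul_add]
    rw [intervalIntegral.integral_add, e₁ r N hN, e₂ r N hN] <;>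
    · apply Continuous.intervalIntegrable; fun_prop
  | smul c f h ih =>
    obtain ⟨g, hg, e⟩ := ih
    refine ⟨c • g, Submodule.smul_mem _ c hg, fun r N hN => ?_⟩
    simp only [Pi.smul_apply, smul_eq_mul, ← e r N hN, mul_left_comm _ c]
    exact intervalIntegral.integral_const_mul _ _

/-- At `r = 1` all phases are trivial; at `r = 0` only monomials with `a = 0`, i.e. `b = d`,
survive. The shared `c d` lets the value at `0` control the leading coefficient at `1`. -/
theorem eval_of_mem_expMonomialSpan {d : ℕ} {f : ℝ → ℤ → ℂ} (hf : f ∈ expMonomialSpan d) :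
    ∃ c : ℕ → ℂ, ∀ N : ℤ, f 1 N = ∑ b ∈ Finset.range (d + 1), c b * ((N : ℂ) ^ b)⁻¹ ∧
      f 0 N = c d * ((N : ℂ) ^ d)⁻¹ := by
  induction hf using Submodule.span_induction with
  | mem f h =>
    obtain ⟨a, b, q, rfl, rfl⟩ := h
    refine ⟨Pi.single b 1, fun N => ⟨?_, ?_⟩⟩
    · rw [Finset.sum_eq_single b (fun j _ hj => by simp [hj])
        fun h => absurd (Finset.mem_range.2 (by omega)) h]
      have := expChar_intCast (N * q)
      push_cast at this
      simp [expMonomial, this]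
    · rcases a with _ | a
      · simp [expMonomial, expChar_zero]
      · simp [expMonomial]
  | zero => exact ⟨0, by simp⟩
  | add f₁ f₂ _ _ ih₁ ih₂ =>
    obtain ⟨c₁, h₁⟩ := ih₁
    obtain ⟨c₂, h₂⟩ := ih₂
    refine ⟨c₁ + c₂, fun N => ?_⟩
    simp [h₁ N, h₂ N, add_mul, Finset.sum_add_distrib]
  | smul c f _ ih =>
    obtain ⟨c₁, h₁⟩ := ih
    refine ⟨c • c₁, fun N => ?_⟩
    simp [h₁ N, Finset.mul_sum, mul_assoc]

/-- The simplex of nonnegative vectors with coordinate sum at most `r`. -/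
def cornerSimplex (d : ℕ) (r : ℝ) : Set (Fin d → ℝ) := {s | (∀ i, 0 ≤ s i) ∧ ∑ i, s i ≤ r}

theorem isClosed_cornerSimplex (d : ℕ) (r : ℝ) : IsClosed (cornerSimplex d r) :=
  (isClosed_le continuous_const continuous_id).inter
    (isClosed_le (continuous_finsetSum _ fun i _ => continuous_apply i) continuous_const)

theorem isCompact_cornerSimplex (d : ℕ) (r : ℝ) : IsCompact (cornerSimplex d r) := by
  refine (isCompact_Icc (a := (0 : Fin d → ℝ)) (b := fun _ => r)).of_isClosed_subset
    (isClosed_cornerSimplex d r) fun s hs => ⟨fun i => hs.1 i, fun i => ?_⟩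
  exact (Finset.single_le_sum (fun j _ => hs.1 j) (Finset.mem_univ i)).trans hs.2

/-- The Fourier integral of the simplex `cornerSimplex d r` at the frequency `N * m`. -/
noncomputable def simplexFourier (d : ℕ) (m : Fin d → ℤ) (r : ℝ) (N : ℤ) : ℂ :=
  ∫ s in cornerSimplex d r, expChar (N * ∑ i, m i * s i)

/-- Fubini: the slice at first coordinate `t` is a corner simplex of radius `r - t`. Substituting `r
- t` for `t` gives the convolution that `expMonomialSpan` is built to absorb. -/
theorem simplexFourier_succ (d : ℕ) (m : Fin (d + 1) → ℤ) {r : ℝ} (hr : 0 ≤ r) (N : ℤ) :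
    simplexFourier (d + 1) m r N = ∫ t in (0 : ℝ)..r,
      expChar (N * m 0 * (r - t)) * simplexFourier d (fun i => m i.succ) t N := by
  have hmp := (volume_preserving_piFinSuccAbove (fun _ : Fin (d + 1) => ℝ) 0).symm
  have hint : Integrable ((cornerSimplex (d + 1) r).indicator
      fun s => expChar (N * ∑ i, m i * s i)) := by
    rw [integrable_indicator_iff (isClosed_cornerSimplex _ _).measurableSet]
    exact Continuous.continuousOn (by fun_prop) |>.integrableOn_compact
      (isCompact_cornerSimplex _ _)
  rw [simplexFourier, ← integral_indicator (isClosed_cornerSimplex _ _).measurableSet,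
    ← hmp.integral_comp (MeasurableEquiv.measurableEmbedding _)]
  have hint' := (hmp.integrable_comp_emb (MeasurableEquiv.measurableEmbedding _)).2 hint
  rw [Measure.volume_eq_prod] at hint' ⊢
  refine (integral_prod _ hint').trans ?_
  have hval : ∀ t : ℝ, (∫ s : Fin d → ℝ, (cornerSimplex (d + 1) r).indicator
      (fun s => expChar (N * ∑ i, m i * s i))
        ((MeasurableEquiv.piFinSuccAbove (fun _ : Fin (d + 1) => ℝ) 0).symm (t, s))) =
      (Set.Icc 0 r).indicator (fun t => expChar (N * m 0 * t) *
        simplexFourier d (fun i => m i.succ) (r - t) N) t := by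
    intro t
    by_cases ht : t ∈ Set.Icc 0 r
    · rw [Set.indicator_of_mem ht, simplexFourier, ← integral_const_mul,
        ← integral_indicator (isClosed_cornerSimplex _ _).measurableSet]
      congr 1 with s
      have : ((MeasurableEquiv.piFinSuccAbove (fun _ : Fin (d + 1) => ℝ) 0).symm (t, s)) ∈
          cornerSimplex (d + 1) r ↔ s ∈ cornerSimplex d (r - t) := by
        simp [cornerSimplex, MeasurableEquiv.piFinSuccAbove, Fin.forall_fin_succ, Fin.sum_univ_succ,
          ht.1, le_sub_iff_add_le']
      by_cases hs : s ∈ cornerSimplex d (r - t)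
      · rw [Set.indicator_of_mem hs, Set.indicator_of_mem (this.2 hs), ← expChar_add]
        congr 1
        simp [MeasurableEquiv.piFinSuccAbove, Fin.sum_univ_succ]
        ring
      · rw [Set.indicator_of_notMem hs, Set.indicator_of_notMem (mt this.1 hs)]
    · rw [Set.indicator_of_notMem ht]
      refine integral_eq_zero_of_ae (Filter.Eventually.of_forall fun s => ?_)
      refine Set.indicator_of_notMem (fun hs => ht ?_) _
      simp [cornerSimplex, MeasurableEquiv.piFinSuccAbove, Fin.forall_fin_succ,
        Fin.sum_univ_succ] at hs
      exact ⟨hs.1.1, by linarith [hs.2, Finset.sum_nonneg fun i (_ : i ∈ Finset.univ) => hs.1.2 i]⟩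
  refine (integral_congr_ae (Filter.Eventually.of_forall hval)).trans ?_
  rw [integral_indicator measurableSet_Icc, integral_Icc_eq_integral_Ioc,
    ← intervalIntegral.integral_of_le hr]
  have := intervalIntegral.integral_comp_sub_left (a := 0) (b := r)
    (fun t => expChar (N * m 0 * (r - t)) * simplexFourier d (fun i => m i.succ) t N) r
  simp only [sub_sub_cancel, sub_self, sub_zero] at this
  exact this

theorem simplexFourier_mem_expMonomialSpan (d : ℕ) : ∀ m : Fin d → ℤ,
    ∃ f ∈ expMonomialSpan d, ∀ r : ℝ, 0 ≤ r → ∀ N : ℤ, N ≠ 0 → simplexFourier d m r N = f r N := by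
  induction d with
  | zero =>
    intro m
    refine ⟨expMonomial 0 0 0, expMonomial_mem 0 rfl, fun r hr N _ => ?_⟩
    have : cornerSimplex 0 r = Set.univ := by
      ext s; simp [cornerSimplex, hr]
    simp [simplexFourier, this, expMonomial, expChar_zero, measureReal_def, volume_pi]
  | succ d ih =>
    intro m
    obtain ⟨f, hf, hfr⟩ := ih fun i => m i.succ
    obtain ⟨g, hg, hgr⟩ := integral_of_mem_expMonomialSpan hf (m 0)
    refine ⟨g, hg, fun r hr N hN => ?_⟩
    rw [simplexFourier_succ d m hr, ← hgr r N hN]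
    refine intervalIntegral.integral_congr fun t ht => ?_
    rw [Set.uIcc_of_le hr] at ht
    simp only [hfr t ht.1 N hN]

theorem simplexFourier_zero_radius (d : ℕ) (m : Fin (d + 1) → ℤ) (N : ℤ) :
    simplexFourier (d + 1) m 0 N = 0 := by
  rw [simplexFourier_succ d m le_rfl, intervalIntegral.integral_same]

/-- The Fourier integral of the unit corner simplex at the frequency `N * m` is a polynomial in
`N⁻¹` of degree less than the dimension. -/
theorem exists_simplexFourier_one_eq_sum (d : ℕ) (m : Fin (d + 1) → ℤ) :
    ∃ c : ℕ → ℂ, ∀ N : ℤ, N ≠ 0 →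
      simplexFourier (d + 1) m 1 N = ∑ b ∈ Finset.range (d + 1), c b * ((N : ℂ) ^ b)⁻¹ := by
  obtain ⟨f, hf, hfr⟩ := simplexFourier_mem_expMonomialSpan (d + 1) m
  obtain ⟨c, hc⟩ := eval_of_mem_expMonomialSpan hf
  refine ⟨c, fun N hN => ?_⟩
  have hN' : (N : ℂ) ≠ 0 := by exact_mod_cast hN
  -- The simplex of radius `0` has zero Fourier integral, which removes the top power of `N⁻¹`.
  have h0 : c (d + 1) = 0 := by
    have h := (hc N).2
    rw [← hfr 0 le_rfl N hN, simplexFourier_zero_radius] at h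
    simpa [hN'] using h.symm
  rw [hfr 1 zero_le_one N hN, (hc N).1, Finset.sum_range_succ, h0, zero_mul, add_zero]

end SimplexFourier

/-! ### Fourier integrals of integer polytopes: expansion, symmetry, scaling. -/

section PolytopeFourier

/-- The Fourier integral of the indicator function of `C` at the integer frequency `k`. -/
noncomputable def setFourier {d : ℕ} (C : Set (Fin d → ℝ)) (k : Fin d → ℤ) : ℂ :=
  ∫ y in C, expChar (∑ i, k i * y i)

theorem convexHull_range_eq_image_cornerSimplex {d : ℕ} {E : Type*} [NormedAddCommGroup E]
    [NormedSpace ℝ E] (v : Fin (d + 1) → E) :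
    convexHull ℝ (Set.range v) =
      (fun s => v 0 + Fintype.linearCombination ℝ (fun j => v (Fin.succ j) - v 0) s) ''
        cornerSimplex d 1 := by
  ext x
  rw [← Set.image_univ, mem_convexHull_image_iff_convexWeights]
  constructor
  · rintro ⟨l, ⟨h0, h1, h2⟩, -⟩
    refine ⟨fun j => l j.succ, ⟨fun j => h0 _, ?_⟩, ?_⟩
    · rw [Fin.sum_univ_succ] at h1
      linarith [h0 0]
    · rw [Fin.sum_univ_succ] at h1 h2
      simp only [Fintype.linearCombination_apply, smul_sub, Finset.sum_sub_distrib,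
        ← Finset.sum_smul]
      rw [← h2, eq_sub_iff_add_eq.2 h1, sub_smul, one_smul]
      abel
  · rintro ⟨s, ⟨h0, h1⟩, rfl⟩
    refine ⟨Fin.cons (1 - ∑ j, s j) s, ⟨fun j => ?_, ?_, ?_⟩, by simp⟩
    · refine Fin.cases ?_ (fun j => ?_) j
      · simpa using h1
      · simpa using h0 j
    · simp [Fin.sum_univ_succ]
    · simp only [Fin.sum_univ_succ, Fin.cons_zero, Fin.cons_succ, Fintype.linearCombination_apply,
        smul_sub, Finset.sum_sub_distrib, ← Finset.sum_smul, sub_smul, one_smul]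
      abel

theorem exists_setFourier_simplex_eq {d : ℕ} (z : Fin (d + 1) → Fin d → ℤ) (k : Fin d → ℤ) :
    ∃ (D : ℝ) (m : Fin d → ℤ), ∀ N : ℤ,
      setFourier (convexHull ℝ (Set.range fun j i => (z j i : ℝ))) (fun i => N * k i) =
        D * simplexFourier d m 1 N := by
  set v : Fin (d + 1) → Fin d → ℝ := fun j i => (z j i : ℝ)
  set L : (Fin d → ℝ) →L[ℝ] (Fin d → ℝ) := LinearMap.toContinuousLinearMap
    (Fintype.linearCombination ℝ (fun j => v (Fin.succ j) - v 0)) with hL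
  have hconv : convexHull ℝ (Set.range v) = (fun s => v 0 + L s) '' cornerSimplex d 1 :=
    convexHull_range_eq_image_cornerSimplex v
  -- Change of variables from the corner simplex: the Jacobian, and the frequency paired with the
  -- integer edge vectors. The base vertex contributes only a trivial phase.
  refine ⟨|L.det|, fun j => ∑ i, k i * (z j.succ i - z 0 i), fun N => ?_⟩
  rw [setFourier, hconv]
  by_cases hdet : L.det = 0
  · rw [hdet, abs_zero, Complex.ofReal_zero, zero_mul]
    refine setIntegral_measure_zero _ ?_
    have : (fun s => v 0 + L s) '' cornerSimplex d 1 =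
        (fun y => v 0 + y) '' (L '' cornerSimplex d 1) := by
      rw [Set.image_image]
    rw [this, Set.image_add_left, measure_preimage_add, Measure.addHaar_image_continuousLinearMap,
      show LinearMap.det (L : (Fin d → ℝ) →ₗ[ℝ] (Fin d → ℝ)) = 0 from hdet]
    simp
  · have hinj : Function.Injective L := by
      exact (LinearEquiv.ofIsUnitDet (f := (L : (Fin d → ℝ) →ₗ[ℝ] (Fin d → ℝ)))
        (v := Pi.basisFun ℝ _) (v' := Pi.basisFun ℝ _) (by
          rw [LinearMap.det_toMatrix]; exact isUnit_iff_ne_zero.2 hdet)).injective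
    rw [integral_image_eq_integral_abs_det_fderiv_smul volume
      (isClosed_cornerSimplex d 1).measurableSet (f' := fun _ => L)
      (fun s _ => (L.hasFDerivAt.const_add _).hasFDerivWithinAt)
      (fun a _ b _ hab => hinj (add_left_cancel hab)), simplexFourier, ← integral_const_mul]
    congr 1 with s
    rw [Complex.real_smul]
    congr 1
    have h1 : expChar ((N * ∑ i, k i * z 0 i : ℤ) : ℝ) = 1 := expChar_intCast _
    rw [← one_mul (expChar (N * _)), ← h1, ← expChar_add]
    congr 1
    have h2 : ∀ i, L s i = ∑ j, s j * ((z j.succ i : ℝ) - z 0 i) := fun i => by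
      simp [hL, Fintype.linearCombination_apply, v]
    simp only [Pi.add_apply, h2]
    push_cast
    simp only [Finset.mul_sum, Finset.sum_mul, mul_add, Finset.sum_add_distrib]
    congr 1
    · exact Finset.sum_congr rfl fun i _ => by simp only [v]; ring
    · rw [Finset.sum_comm]
      exact Finset.sum_congr rfl fun i _ => Finset.sum_congr rfl fun j _ => by ring

theorem setIntegral_convexHull_eq_sum {ι E F : Type*} [Fintype ι] [NormedAddCommGroup E]
    [NormedSpace ℝ E] [FiniteDimensional ℝ E] [MeasurableSpace E] [BorelSpace E]
    [NormedAddCommGroup F] [NormedSpace ℝ F] (μ : Measure E) [μ.IsAddHaarMeasure] (p : ι → E) :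
    ∃ T : Finset (Finset ι), (∀ S ∈ T, S.card = Module.finrank ℝ E + 1) ∧
      ∀ f : E → F, Continuous f → ∫ x in convexHull ℝ (Set.range p), f x ∂μ =
        ∑ S ∈ T, ∫ x in convexHull ℝ (p '' (S : Set ι)), f x ∂μ := by
  classical
  obtain ⟨T, hT, hae⟩ := exists_triangulation μ p
  have hcomp : ∀ V : Set E, V.Finite → IsCompact (convexHull ℝ V) := fun V hV =>
    hV.isCompact_convexHull (𝕜 := ℝ)
  refine ⟨T, hT, fun f hf => ?_⟩
  have hS : ∀ S : Finset ι, (p '' (S : Set ι)).Finite := fun S => S.finite_toSet.image p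
  rw [← integral_indicator (hcomp _ (Set.finite_range p)).measurableSet]
  simp_rw [fun S : Finset ι => (integral_indicator (μ := μ) (f := f)
    (hcomp _ (hS S)).measurableSet).symm]
  rw [← integral_finsetSum]
  · refine integral_congr_ae ?_
    filter_upwards [hae] with x hx
    by_cases hxP : x ∈ convexHull ℝ (Set.range p)
    · obtain ⟨S, hST, hS'⟩ := hx hxP
      rw [Set.indicator_of_mem hxP, Finset.sum_eq_single S (fun S' h1 h2 =>
        Set.indicator_of_notMem (fun h => h2 ((hS' S' h1).1 h)) _) (fun h => absurd hST h),
        Set.indicator_of_mem ((hS' S hST).2 rfl)]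
    · rw [Set.indicator_of_notMem hxP]
      refine (Finset.sum_eq_zero fun S _ => Set.indicator_of_notMem (fun h => hxP ?_) _).symm
      exact convexHull_mono (Set.image_subset_range _ _) h
  · intro S _
    rw [integrable_indicator_iff (hcomp _ (hS S)).measurableSet]
    exact hf.continuousOn.integrableOn_compact (hcomp _ (hS S))

theorem IsIntegerPolytope.isCompact {d : ℕ} {P : Set (Fin d → ℝ)} (hP : IsIntegerPolytope P) :
    IsCompact P := by
  obtain ⟨V, hV, -, rfl⟩ := hP
  exact hV.isCompact_convexHull (𝕜 := ℝ)

theorem IsIntegerPolytope.exists_setFourier_eq_sum {d : ℕ} {P : Set (Fin (d + 1) → ℝ)}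
    (hP : IsIntegerPolytope P) (k : Fin (d + 1) → ℤ) :
    ∃ c : ℕ → ℂ, ∀ N : ℤ, N ≠ 0 →
      setFourier P (fun i => N * k i) = ∑ b ∈ Finset.range (d + 1), c b * ((N : ℂ) ^ b)⁻¹ := by
  classical
  obtain ⟨V, hV, hint, rfl⟩ := hP
  have := hV.fintype
  choose z hz using fun v : V => hint v v.2
  obtain ⟨T, hT, hsum⟩ := setIntegral_convexHull_eq_sum (F := ℂ) volume
    (Subtype.val : V → Fin (d + 1) → ℝ)
  rw [Subtype.range_coe] at hsum
  have hsimplex : ∀ S ∈ T, ∃ c : ℕ → ℂ, ∀ N : ℤ, N ≠ 0 →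
      setFourier (convexHull ℝ (Subtype.val '' (S : Set V))) (fun i => N * k i) =
        ∑ b ∈ Finset.range (d + 1), c b * ((N : ℂ) ^ b)⁻¹ := by
    intro S hS
    have hcard : S.card = d + 1 + 1 := by rw [hT S hS, Module.finrank_fin_fun]
    let e := (S.equivFinOfCardEq hcard).symm
    obtain ⟨D, m, h⟩ := exists_setFourier_simplex_eq (fun j => z (e j)) k
    have hrange : Set.range (fun (j : Fin (d + 1 + 1)) (i : Fin (d + 1)) => (z (e j) i : ℝ)) =
        Subtype.val '' (S : Set V) := by
      have : (fun (j : Fin (d + 1 + 1)) (i : Fin (d + 1)) => (z (e j) i : ℝ)) =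
          (fun s : S => ((s : V) : Fin (d + 1) → ℝ)) ∘ e := by
        funext j i
        exact (hz _ i).symm
      rw [this, e.surjective.range_comp]
      ext x
      simp
    rw [hrange] at h
    obtain ⟨c, hc⟩ := exists_simplexFourier_one_eq_sum d m
    refine ⟨fun b => D * c b, fun N hN => ?_⟩
    rw [h, hc N hN, Finset.mul_sum]
    exact Finset.sum_congr rfl fun b _ => (mul_assoc _ _ _).symm
  choose! c hc using hsimplex
  refine ⟨fun b => ∑ S ∈ T, c S b, fun N hN => ?_⟩
  rw [setFourier, hsum _ (by fun_prop)]
  simp_rw [Finset.sum_mul]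
  rw [Finset.sum_comm]
  exact Finset.sum_congr rfl fun S hS => hc S hS N hN

/-- Riemann–Lebesgue along the ray through `k`. -/
theorem tendsto_setFourier_atTop {d : ℕ} {C : Set (Fin d → ℝ)} (hC : MeasurableSet C)
    {k : Fin d → ℤ} (hk : k ≠ 0) :
    Filter.Tendsto (fun n : ℕ => setFourier C (fun i => n * k i)) Filter.atTop (nhds 0) := by
  let w : StrongDual ℝ (Fin d → ℝ) := ∑ i, (k i : ℝ) • ContinuousLinearMap.proj i
  have hw : w ≠ 0 := by
    intro h
    apply hk
    funext i
    have := congrArg (fun f : StrongDual ℝ (Fin d → ℝ) => f (Pi.single i 1)) h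
    simpa [w, Pi.single_apply] using this
  have h := tendsto_integral_exp_smul_cocompact (C.indicator fun _ => (1 : ℂ)) volume
  have hlim : Filter.Tendsto (fun n : ℕ => -((n : ℝ) • w)) Filter.atTop
      (Filter.cocompact (StrongDual ℝ (Fin d → ℝ))) := by
    rw [← Metric.cobounded_eq_cocompact, ← tendsto_norm_atTop_iff_cobounded]
    simp only [norm_neg, norm_smul, Real.norm_natCast]
    exact tendsto_natCast_atTop_atTop.atTop_mul_const (norm_pos_iff.2 hw)
  refine (h.comp hlim).congr fun n => ?_
  rw [setFourier, ← integral_indicator hC]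
  refine integral_congr_ae (Filter.Eventually.of_forall fun y => ?_)
  by_cases hy : y ∈ C
  · simp only [Set.indicator_of_mem hy, Circle.smul_def, smul_eq_mul, mul_one,
      Real.fourierChar_apply, expChar]
    congr 1
    simp [w, Finset.mul_sum, mul_assoc, mul_comm, mul_left_comm]
  · simp [Set.indicator_of_notMem hy]

/-- The reflection maps extreme points to extreme points, and these are integer; an extreme point
and its image sum to `2c`. -/
theorem IsIntegerPolytope.exists_two_smul_center {d : ℕ} {P : Set (Fin d → ℝ)}
    (hP : IsIntegerPolytope P) (hne : P.Nonempty) {c : Fin d → ℝ}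
    (hc : ∀ x ∈ P, (2 : ℝ) • c - x ∈ P) : IsIntegerPoint ((2 : ℝ) • c) := by
  have hcomp := hP.isCompact
  obtain ⟨V, hV, hint, rfl⟩ := hP
  obtain ⟨v, hv⟩ := hcomp.extremePoints_nonempty hne
  have hv' : (2 : ℝ) • c - v ∈ (convexHull ℝ V).extremePoints ℝ := by
    refine ⟨hc v hv.1, fun x hx y hy hxy => ?_⟩
    have h : v ∈ openSegment ℝ ((2 : ℝ) • c - x) ((2 : ℝ) • c - y) := by
      obtain ⟨a, b, ha, hb, hab, h⟩ := hxy
      refine ⟨a, b, ha, hb, hab, ?_⟩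
      have : a • ((2 : ℝ) • c - x) + b • ((2 : ℝ) • c - y) =
          (a + b) • ((2 : ℝ) • c) - (a • x + b • y) := by module
      rw [this, h, hab, one_smul, sub_sub_cancel]
    have := hv.2 (hc x hx) (hc y hy) h
    rw [← this, sub_sub_cancel]
  intro i
  obtain ⟨a, ha⟩ := hint v (extremePoints_convexHull_subset hv) i
  obtain ⟨b, hb⟩ := hint _ (extremePoints_convexHull_subset hv') i
  refine ⟨b + a, ?_⟩
  rw [Int.cast_add, ← ha, ← hb, Pi.sub_apply, sub_add_cancel]

theorem IsIntegerPolytope.setFourier_neg {d : ℕ} {P : Set (Fin d → ℝ)}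
    (hP : IsIntegerPolytope P) (hsymm : IsCentrallySymmetric P) (k : Fin d → ℤ) :
    setFourier P (fun i => -k i) = setFourier P k := by
  rcases P.eq_empty_or_nonempty with rfl | hne
  · simp [setFourier]
  obtain ⟨c, hc⟩ := hsymm
  choose z hz using hP.exists_two_smul_center hne hc
  have hmeas := hP.isCompact.measurableSet
  rw [setFourier, setFourier, ← integral_indicator hmeas, ← integral_indicator hmeas,
    ← integral_sub_left_eq_self _ volume ((2 : ℝ) • c)]
  congr 1 with y
  by_cases hy : y ∈ P
  · rw [Set.indicator_of_mem hy, Set.indicator_of_mem (hc y hy)]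
    -- Reflecting `y` to `2c - y` costs the phase of `k` at `2c`, trivial because `2c` is integer.
    have h : expChar ((∑ i, k i * z i : ℤ) : ℝ) = 1 := expChar_intCast _
    rw [← one_mul (expChar (∑ i, ((-k i : ℤ) : ℝ) * _)), ← h, ← expChar_add]
    congr 1
    push_cast
    rw [← Finset.sum_add_distrib]
    exact Finset.sum_congr rfl fun i _ => by rw [Pi.sub_apply, hz i]; ring
  · rw [Set.indicator_of_notMem hy, Set.indicator_of_notMem]
    exact fun h => hy (by simpa using hc _ h)

theorem setFourier_smul {d : ℕ} (C : Set (Fin d → ℝ)) {n : ℕ} (hn : 0 < n) (k : Fin d → ℤ) :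
    setFourier ((n : ℝ) • C) k = (n : ℂ) ^ d * setFourier C (fun i => n * k i) := by
  have hn' : (n : ℝ) ≠ 0 := by positivity
  have h := Measure.setIntegral_comp_smul volume
    (fun y : Fin d → ℝ => expChar (∑ i, k i * y i)) C hn'
  rw [setFourier, setFourier]
  have h2 : ∀ y : Fin d → ℝ, expChar (∑ i, k i * ((n : ℝ) • y) i) =
      expChar (∑ i, ((n * k i : ℤ) : ℝ) * y i) := fun y => by
    congr 1
    exact Finset.sum_congr rfl fun i _ => by rw [Pi.smul_apply, smul_eq_mul]; push_cast; ring
  simp only [h2] at h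
  rw [h, Module.finrank_fin_fun, abs_of_pos (by positivity), Complex.real_smul]
  push_cast
  rw [mul_inv_cancel_left₀ (by exact_mod_cast pow_ne_zero d (by exact_mod_cast hn.ne'))]

theorem IsIntegerPolytope.setFourier_smul_four {P : Set (Fin 4 → ℝ)}
    (hP : IsIntegerPolytope P) (hsymm : IsCentrallySymmetric P) {n : ℕ} (hn : 0 < n)
    {k : Fin 4 → ℤ} (hk : k ≠ 0) :
    setFourier ((n : ℝ) • P) k = (n : ℂ) ^ 2 * setFourier P k := by
  obtain ⟨c, hc⟩ := hP.exists_setFourier_eq_sum k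
  have hc0 : c 0 = 0 := by
    have h1 : Filter.Tendsto (fun N : ℕ => ∑ b ∈ Finset.range (3 + 1), c b * ((N : ℂ) ^ b)⁻¹)
        Filter.atTop (nhds (∑ b ∈ Finset.range (3 + 1), if b = 0 then c 0 else 0)) := by
      refine tendsto_finsetSum _ fun b _ => ?_
      rcases b with _ | b
      · simp
      · have h := ((tendsto_inv_atTop_nhds_zero_nat (𝕜 := ℂ)).pow (b + 1)).const_mul (c (b + 1))
        simpa using h
    have h2 := tendsto_setFourier_atTop hP.isCompact.measurableSet hk
    have h3 := tendsto_nhds_unique (h2.congr' ?_) h1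
    · simpa using h3.symm
    · filter_upwards [Filter.eventually_gt_atTop 0] with N hN
      have := hc N (by omega)
      push_cast at this
      exact this
  -- Evenness kills the odd part; its values at `N = 1` and `N = 2` already force `c 1 = c 3 = 0`.
  have heven : ∀ N : ℤ, N ≠ 0 → c 1 * (N : ℂ)⁻¹ + c 3 * ((N : ℂ) ^ 3)⁻¹ = 0 := by
    intro N hN
    have h1 := hc N hN
    have h2 := hc (-N) (by omega)
    have h3 := hP.setFourier_neg hsymm fun i => N * k i
    simp only [← neg_mul] at h3
    rw [h3, h1] at h2
    simp only [Finset.sum_range_succ, Finset.sum_range_zero, Int.cast_neg] at h2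
    have hN' : (N : ℂ) ≠ 0 := by exact_mod_cast hN
    rw [neg_sq, Odd.neg_pow (by decide : Odd 3), inv_neg] at h2
    simp only [pow_zero, pow_one, inv_neg] at h2
    linear_combination h2 / 2
  have h1 := heven 1 one_ne_zero
  have h2 := heven 2 two_ne_zero
  have hc3 : c 3 = 0 := by
    norm_num at h1 h2
    linear_combination (4 / 3 : ℂ) * h1 - (8 / 3 : ℂ) * h2
  have hc1 : c 1 = 0 := by simpa [hc3] using h1
  have hn' : (n : ℂ) ≠ 0 := by exact_mod_cast hn.ne'
  have hN := hc n (by omega)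
  have h1' := hc 1 one_ne_zero
  simp only [Finset.sum_range_succ, Finset.sum_range_zero, hc0, hc1, hc3, Int.cast_natCast,
    Int.cast_one, one_mul] at hN h1'
  rw [setFourier_smul P hn, hN, h1']
  field_simp
  ring

end PolytopeFourier

/-! ### The lattice count as a function of the shift, and its Fourier coefficients. -/

section LatticeCount

theorem latticeCount_eq_ncard {d : ℕ} (C : Set (Fin d → ℝ)) (x : Fin d → ℝ) :
    latticeCount C x = {m : Fin d → ℤ | (fun i => (m i : ℝ) - x i) ∈ C}.ncard := by
  have hinj : Function.Injective fun (m : Fin d → ℤ) (i : Fin d) => (m i : ℝ) := by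
    intro m m' h
    funext i
    exact Int.cast_injective (congrFun h i)
  rw [latticeCount, ← Set.ncard_image_of_injective _ hinj]
  congr 1
  ext y
  constructor
  · rintro ⟨hy, hint⟩
    choose m hm using hint
    obtain ⟨a, ha, b, hb, hab⟩ := Set.mem_add.1 hy
    rw [Set.mem_singleton_iff] at hb
    subst hb
    refine ⟨m, ?_, funext fun i => (hm i).symm⟩
    have : (fun i => (m i : ℝ) - b i) = a := by
      funext i
      rw [← hm i, ← hab, Pi.add_apply, add_sub_cancel_right]
    rwa [Set.mem_ofPred_eq, this]
  · rintro ⟨m, hm, rfl⟩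
    exact ⟨Set.mem_add.2 ⟨_, hm, x, rfl, funext fun i => sub_add_cancel _ _⟩, fun i => ⟨m i, rfl⟩⟩

theorem exists_finset_shift_mem {d : ℕ} {C : Set (Fin d → ℝ)} (hC : Bornology.IsBounded C) :
    ∃ B : Finset (Fin d → ℤ), ∀ x ∈ Set.Icc (0 : Fin d → ℝ) 1, ∀ m : Fin d → ℤ,
      (fun i => (m i : ℝ) - x i) ∈ C → m ∈ B := by
  obtain ⟨R, hR⟩ := hC.exists_norm_le
  refine ⟨Finset.Icc (fun _ => -⌈R⌉) (fun _ => ⌈R⌉ + 1), fun x hx m hm => ?_⟩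
  have h : ∀ i, |(m i : ℝ) - x i| ≤ R := fun i => (norm_le_pi_norm _ i).trans (hR _ hm)
  have hRc := Int.le_ceil R
  rw [Finset.mem_Icc]
  constructor <;> intro i <;> have h0 := hx.1 i <;> have h1 := hx.2 i <;>
    have h2 := abs_le.1 (h i) <;> simp only [Pi.zero_apply, Pi.one_apply] at h0 h1
  · have : (-⌈R⌉ : ℝ) ≤ m i := by linarith [h2.1]
    exact_mod_cast this
  · have : (m i : ℝ) ≤ ⌈R⌉ + 1 := by linarith [h2.2]
    exact_mod_cast this

theorem latticeCount_eq_sum {d : ℕ} {C : Set (Fin d → ℝ)} {B : Finset (Fin d → ℤ)}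
    {x : Fin d → ℝ} (hB : ∀ m : Fin d → ℤ, (fun i => (m i : ℝ) - x i) ∈ C → m ∈ B) :
    (latticeCount C x : ℝ) = ∑ m ∈ B, C.indicator 1 (fun i => (m i : ℝ) - x i) := by
  classical
  have : {m : Fin d → ℤ | (fun i => (m i : ℝ) - x i) ∈ C} =
      (B.filter fun m => (fun i => (m i : ℝ) - x i) ∈ C : Finset (Fin d → ℤ)) := by
    ext m
    simpa using hB m
  rw [latticeCount_eq_ncard, this, Set.ncard_coe_finset, Finset.card_filter]
  push_cast
  simp [Set.indicator_apply]

theorem memLp_latticeCount {d : ℕ} {C : Set (Fin d → ℝ)} (hC : IsCompact C) {p : ENNReal} :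
    MemLp (fun x => (latticeCount C x : ℝ)) p (volume.restrict (Set.Icc 0 1)) := by
  obtain ⟨B, hB⟩ := exists_finset_shift_mem hC.isBounded
  have h : (fun x => ∑ m ∈ B, C.indicator (1 : (Fin d → ℝ) → ℝ) (fun i => (m i : ℝ) - x i))
      =ᵐ[volume.restrict (Set.Icc 0 1)] fun x => (latticeCount C x : ℝ) := by
    filter_upwards [ae_restrict_mem measurableSet_Icc] with x hx
    exact (latticeCount_eq_sum (hB x hx)).symm
  have hfin : IsFiniteMeasure (volume.restrict (Set.Icc (0 : Fin d → ℝ) 1)) :=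
    ⟨by rw [Measure.restrict_apply_univ]; exact isCompact_Icc.measure_lt_top⟩
  refine (memLp_finsetSum B fun m _ => ?_).ae_eq h
  have hmeas : Measurable fun x : Fin d → ℝ => C.indicator (1 : (Fin d → ℝ) → ℝ)
      (fun i => (m i : ℝ) - x i) :=
    (measurable_one.indicator hC.measurableSet).comp (by fun_prop)
  refine MemLp.of_bound hmeas.aestronglyMeasurable 1 (Filter.Eventually.of_forall fun x => ?_)
  exact (norm_indicator_le_norm_self _ _).trans (by simp)

/-- The half-open unit cube. -/
def unitCube (d : ℕ) : Set (Fin d → ℝ) := {x | ∀ i, x i ∈ Set.Ioc 0 1}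

theorem measurableSet_unitCube (d : ℕ) : MeasurableSet (unitCube d) :=
  MeasurableSet.univ_pi' fun _ => measurableSet_Ioc

theorem unitCube_subset_Icc (d : ℕ) : unitCube d ⊆ Set.Icc 0 1 :=
  fun _ hx => ⟨fun i => (hx i).1.le, fun i => (hx i).2⟩

theorem unitCube_ae_eq_Icc (d : ℕ) : unitCube d =ᵐ[volume] Set.Icc (0 : Fin d → ℝ) 1 := by
  have : unitCube d = Set.univ.pi fun _ => Set.Ioc (0 : ℝ) 1 := by
    ext x; simp [unitCube]
  rw [this]
  exact Measure.univ_pi_Ioc_ae_eq_Icc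

/-- The Fourier coefficients of the lattice point count are the Fourier integrals of the set. -/
theorem integral_expChar_mul_latticeCount {d : ℕ} {C : Set (Fin d → ℝ)} (hC : IsCompact C)
    (k : Fin d → ℤ) :
    ∫ x in unitCube d, expChar (-∑ i, k i * x i) * (latticeCount C x : ℂ) = setFourier C k := by
  obtain ⟨B, hB⟩ := exists_finset_shift_mem hC.isBounded
  let f : (Fin d → ℝ) → ℂ := C.indicator fun y => expChar (∑ i, k i * y i)
  have hf : Integrable f := by
    rw [integrable_indicator_iff hC.measurableSet]
    exact (Continuous.continuousOn (by fun_prop)).integrableOn_compact hC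
  -- Substituting `y = m - x` sends the cube to the cell `Q m`. The half-open cells tile space, `y`
  -- lying only in the one with `m i = ⌊y i⌋ + 1`, so the sum over `m` unfolds to an integral over
  -- `C`.
  let Q : (Fin d → ℤ) → Set (Fin d → ℝ) := fun m => {y | (fun i => (m i : ℝ) - y i) ∈ unitCube d}
  have hQ : ∀ m, MeasurableSet (Q m) := fun m =>
    (measurableSet_unitCube d).preimage (f := fun (y : Fin d → ℝ) i => (m i : ℝ) - y i)
      (by fun_prop)
  have h1 : ∀ x ∈ unitCube d, expChar (-∑ i, k i * x i) * (latticeCount C x : ℂ) =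
      ∑ m ∈ B, f (fun i => (m i : ℝ) - x i) := by
    intro x hx
    have h := latticeCount_eq_sum (hB x (unitCube_subset_Icc d hx))
    have h' : (latticeCount C x : ℂ) = ((latticeCount C x : ℝ) : ℂ) := by simp
    rw [h', h]
    push_cast
    rw [Finset.mul_sum]
    refine Finset.sum_congr rfl fun m _ => ?_
    by_cases hm : (fun i => (m i : ℝ) - x i) ∈ C
    · simp only [f, Set.indicator_of_mem hm, Pi.one_apply, Complex.ofReal_one, mul_one]
      have h2 : expChar ((∑ i, k i * m i : ℤ) : ℝ) = 1 := expChar_intCast _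
      rw [← mul_one (expChar _), ← h2, ← expChar_add]
      congr 1
      push_cast
      simp only [mul_sub, Finset.sum_sub_distrib]
      ring
    · simp [f, Set.indicator_of_notMem hm]
  have h2 : ∀ m : Fin d → ℤ, ∫ x in unitCube d, f (fun i => (m i : ℝ) - x i) =
      ∫ y, (Q m).indicator f y := by
    intro m
    rw [← integral_indicator (measurableSet_unitCube d),
      ← integral_sub_left_eq_self _ volume (fun i => (m i : ℝ))]
    congr 1 with y
    by_cases hy : y ∈ Q m
    · rw [Set.indicator_of_mem hy]
      refine (Set.indicator_of_mem (s := unitCube d) hy _).trans (congrArg f ?_)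
      funext i
      exact sub_sub_cancel _ _
    · rw [Set.indicator_of_notMem hy]
      exact Set.indicator_of_notMem (s := unitCube d) hy _
  rw [setIntegral_congr_fun (measurableSet_unitCube d) h1, integral_finsetSum]
  · simp_rw [h2]
    rw [← integral_finsetSum _ fun m _ => hf.indicator (hQ m), setFourier,
      ← integral_indicator hC.measurableSet]
    congr 1 with y
    by_cases hy : y ∈ C
    · have hmem : y ∈ Q fun i => ⌊y i⌋ + 1 := fun i => by
        push_cast
        constructor
        · linarith [Int.lt_floor_add_one (y i)]
        · linarith [Int.floor_le (y i)]
      rw [Finset.sum_eq_single fun i => ⌊y i⌋ + 1]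
      · rw [Set.indicator_of_mem hmem]
      · intro m _ hm
        refine Set.indicator_of_notMem (fun hmem' => hm ?_) _
        funext i
        have h3 := hmem' i
        have : ⌊y i⌋ = m i - 1 := by
          rw [Int.floor_eq_iff]
          push_cast
          constructor
          · linarith [h3.2]
          · linarith [h3.1]
        rw [this]; ring
      · intro hnot
        refine absurd (hB _ (unitCube_subset_Icc d hmem) _ ?_) hnot
        simpa only [sub_sub_cancel] using hy
    · have : f y = 0 := Set.indicator_of_notMem hy _
      rw [Set.indicator_of_notMem hy]
      refine Finset.sum_eq_zero fun m _ => ?_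
      exact Set.indicator_apply_eq_zero.2 fun _ => this
  · intro m _
    have : Integrable fun x : Fin d → ℝ => f ((fun i => (m i : ℝ)) - x) :=
      hf.comp_sub_left _
    exact this.integrableOn

end LatticeCount

/-! ### Uniqueness of Fourier coefficients in L² of the torus, carried to the cube. -/

section Uniqueness

attribute [local instance] instMeasureSpaceUnitAddCircle instIsProbabilityMeasureUnitAddCircleVolume

open UnitAddTorus in
theorem ae_eq_const_of_mFourierCoeff_eq_zero {d : Type*} [Fintype d] {h : UnitAddTorus d → ℂ}
    (hh : MemLp h 2) (h0 : ∀ k : d → ℤ, k ≠ 0 → mFourierCoeff h k = 0) :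
    ∃ c : ℂ, ∀ᵐ t, h t = c := by
  have hcoeff : ∀ k, mFourierCoeff (hh.toLp h) k = mFourierCoeff h k := fun k =>
    integral_congr_ae (hh.coeFn_toLp.mono fun t ht => by simp only [ht])
  have hsum := hasSum_mFourier_series_L2 (hh.toLp h)
  -- The L² Fourier series converges to `h` and also reduces to its constant term.
  have heq := hsum.unique (hasSum_single 0 fun k hk => by rw [hcoeff, h0 k hk, zero_smul])
  refine ⟨mFourierCoeff (hh.toLp h) 0, ?_⟩
  filter_upwards [hh.coeFn_toLp, Lp.coeFn_smul (mFourierCoeff (hh.toLp h) 0) (mFourierLp 2 0),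
    coeFn_mFourierLp 2 (0 : d → ℤ)] with t h1 h2 h3
  rw [← h1]
  conv_lhs => rw [heq]
  rw [h2, Pi.smul_apply, h3, mFourier_zero]
  simp

open UnitAddTorus in
/-- A square-integrable function on the cube all of whose nontrivial Fourier coefficients vanish
is constant. -/
theorem ae_eq_const_of_fourierCoeff_eq_zero {d : ℕ} {g : (Fin d → ℝ) → ℂ}
    (hg : MemLp g 2 (volume.restrict (unitCube d)))
    (h0 : ∀ k : Fin d → ℤ, k ≠ 0 → ∫ x in unitCube d, expChar (-∑ i, k i * x i) * g x = 0) :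
    ∃ c : ℂ, ∀ᵐ x ∂volume.restrict (unitCube d), g x = c := by
  have hcube : unitCube d =
      {x | ∀ i, x i ∈ Set.Ioc ((0 : Fin d → ℝ) i) ((0 : Fin d → ℝ) i + 1)} := by
    simp [unitCube]
  have hm : MeasurableSet
      {x : Fin d → ℝ | ∀ i, x i ∈ Set.Ioc ((0 : Fin d → ℝ) i) ((0 : Fin d → ℝ) i + 1)} :=
    hcube ▸ measurableSet_unitCube d
  let e := measurableEquivPiIoc (0 : Fin d → ℝ)
  have he : MeasurePreserving e volume (Measure.comap Subtype.val volume) :=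
    measurePreserving_equivPiIoc 0
  have hval : MeasurePreserving (fun t => (e t : Fin d → ℝ)) volume
      (volume.restrict (unitCube d)) := by
    rw [hcube]
    exact (measurePreserving_subtype_coe hm).comp he
  have hlift : ∀ x ∈ unitCube d, ((e fun i => (x i : UnitAddCircle)) : Fin d → ℝ) = x := by
    intro x hx
    rw [hcube] at hx
    exact congrArg Subtype.val (e.apply_symm_apply ⟨x, hx⟩)
  obtain ⟨c, hc⟩ := ae_eq_const_of_mFourierCoeff_eq_zero (h := fun t => g (e t))
    (hg.comp_measurePreserving hval) fun k hk => by
      rw [mFourierCoeff_eq_integral _ _ 0, ← hcube, ← h0 k hk]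
      refine setIntegral_congr_fun (measurableSet_unitCube d) fun x hx => ?_
      simp only [smul_eq_mul, hlift x hx]
      congr 1
      simp only [mFourier, ContinuousMap.coe_mk, fourier_coe_apply, expChar, ← Complex.exp_sum]
      congr 1
      push_cast
      rw [← Finset.sum_neg_distrib, Finset.mul_sum]
      exact Finset.sum_congr rfl fun i _ => by simp; ring
  refine ⟨c, ?_⟩
  have h1 := he.symm.quasiMeasurePreserving.ae hc
  rw [hcube, ae_restrict_iff_subtype hm]
  filter_upwards [h1] with x hx
  have hx' : g (e (e.symm x)) = c := hx
  have hex : ((e (e.symm x)) : Fin d → ℝ) = x := congrArg Subtype.val (e.apply_symm_apply x)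
  rwa [hex] at hx'

end Uniqueness

/-! ### Comparison of the two counts and transfer to the random variables. -/

theorem IsIntegerPolytope.latticeCount_smul_sub_ae_eq_const {P : Set (Fin 4 → ℝ)}
    (hP : IsIntegerPolytope P) (hsymm : IsCentrallySymmetric P) {n : ℕ} (hn : 0 < n) :
    ∃ c : ℝ, ∀ᵐ x ∂volume.restrict (Set.Icc (0 : Fin 4 → ℝ) 1),
      (latticeCount ((n : ℝ) • P) x : ℝ) - (n : ℝ) ^ 2 * latticeCount P x = c := by
  have hcP := hP.isCompact
  have hcnP : IsCompact ((n : ℝ) • P) := hcP.smul _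
  have hmem : ∀ {C : Set (Fin 4 → ℝ)}, IsCompact C →
      MemLp (fun x => (latticeCount C x : ℂ)) 2 (volume.restrict (unitCube 4)) := fun hC => by
    have h := (memLp_latticeCount hC (p := 2)).ofReal (K := ℂ)
    rw [← Measure.restrict_congr_set (unitCube_ae_eq_Icc 4)] at h
    simpa using h
  have hfin : IsFiniteMeasure (volume.restrict (unitCube 4)) :=
    ⟨by
      rw [Measure.restrict_apply_univ, measure_congr (unitCube_ae_eq_Icc 4)]
      exact isCompact_Icc.measure_lt_top⟩
  have hint : ∀ {C : Set (Fin 4 → ℝ)}, IsCompact C → ∀ k : Fin 4 → ℤ,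
      Integrable (fun x => expChar (-∑ i, (k i : ℝ) * x i) * (latticeCount C x : ℂ))
        (volume.restrict (unitCube 4)) := fun hC k =>
    ((hmem hC).integrable (by norm_num)).bdd_mul (c := 1)
      (Continuous.aestronglyMeasurable (by fun_prop))
      (Filter.Eventually.of_forall fun x => (norm_expChar _).le)
  obtain ⟨c, hc⟩ := ae_eq_const_of_fourierCoeff_eq_zero
    (g := fun x => (latticeCount ((n : ℝ) • P) x : ℂ) - (n : ℂ) ^ 2 * latticeCount P x)
    ((hmem hcnP).sub ((hmem hcP).const_mul _)) fun k hk => by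
      simp only [mul_sub, mul_left_comm _ ((n : ℂ) ^ 2)]
      rw [integral_sub (hint hcnP k) ((hint hcP k).const_mul _), integral_const_mul,
        integral_expChar_mul_latticeCount hcnP, integral_expChar_mul_latticeCount hcP,
        hP.setFourier_smul_four hsymm hn hk, sub_self]
  refine ⟨c.re, ?_⟩
  rw [← Measure.restrict_congr_set (unitCube_ae_eq_Icc 4)]
  filter_upwards [hc] with x hx
  have := congrArg Complex.re hx
  rw [← this]
  norm_cast

theorem map_eq_restrict_of_isUniform_Icc {Ω : Type*} [MeasurableSpace Ω] {μ : Measure Ω} {d : ℕ}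
    {X : Ω → Fin d → ℝ} (hX : pdf.IsUniform X (Set.Icc (0 : Fin d → ℝ) 1) μ volume) :
    μ.map X = volume.restrict (Set.Icc (0 : Fin d → ℝ) 1) := by
  have hvol : volume (Set.Icc (0 : Fin d → ℝ) 1) = 1 := by simp [Real.volume_Icc_pi]
  have h : μ.map X = cond volume (Set.Icc (0 : Fin d → ℝ) 1) := hX
  rw [h, ProbabilityTheory.cond, hvol, inv_one, one_smul]

theorem mainTheorem7 {Ω : Type*} [MeasurableSpace Ω] (μ : Measure Ω)
    (X : Ω → Fin 4 → ℝ)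
    (hX : pdf.IsUniform X (Set.Icc (0 : Fin 4 → ℝ) 1) μ volume)
    (P : Set (Fin 4 → ℝ)) (hP : IsIntegerPolytope P) (hsymm : IsCentrallySymmetric P)
    (n : ℕ) (hn : 0 < n) :
    MemLp (shiftCount X P) 2 μ ∧
    MemLp (shiftCount X ((n : ℝ) • P)) 2 μ ∧
    EqUpToConst μ (shiftCount X ((n : ℝ) • P)) (fun ω => (n : ℝ) ^ 2 * shiftCount X P ω) ∧
    variance (shiftCount X ((n : ℝ) • P)) μ = (n : ℝ) ^ 4 * variance (shiftCount X P) μ := by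
  have hvol : volume (Set.Icc (0 : Fin 4 → ℝ) 1) = 1 := by simp [Real.volume_Icc_pi]
  have hmeas : AEMeasurable X μ := hX.aemeasurable (by simp [hvol]) (by simp [hvol])
  have : IsProbabilityMeasure μ := hX.isProbabilityMeasure (by simp [hvol]) (by simp [hvol])
  have hmap := map_eq_restrict_of_isUniform_Icc hX
  have hmem : ∀ {C : Set (Fin 4 → ℝ)}, IsCompact C → MemLp (shiftCount X C) 2 μ := fun hC => by
    have h := memLp_latticeCount hC (p := 2)
    rw [← hmap] at h
    exact h.comp_of_map hmeas
  have hcP := hP.isCompact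
  have hP2 := hmem hcP
  have hnP2 := hmem (hcP.smul (n : ℝ))
  obtain ⟨c, hc⟩ := hP.latticeCount_smul_sub_ae_eq_const hsymm hn
  rw [← hmap] at hc
  have hae : ∀ᵐ ω ∂μ, shiftCount X ((n : ℝ) • P) ω = (n : ℝ) ^ 2 * shiftCount X P ω + c := by
    filter_upwards [ae_of_ae_map hmeas hc] with ω hω
    rw [← hω]
    simp only [shiftCount]
    ring
  have hint : Integrable (shiftCount X P) μ := hP2.integrable (by norm_num)
  refine ⟨hP2, hnP2, ?_, ?_⟩
  · have hE : ∫ ω, shiftCount X ((n : ℝ) • P) ω ∂μ =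
        (∫ ω, (n : ℝ) ^ 2 * shiftCount X P ω ∂μ) + c := by
      rw [integral_congr_ae hae, integral_add (hint.const_mul _) (integrable_const c)]
      simp
    filter_upwards [hae] with ω hω
    rw [hω, hE]
    ring
  · rw [variance_congr hae, variance_add_const (hP2.const_mul _).aestronglyMeasurable,
      variance_const_mul, ← pow_mul]
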